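/- Let $\mathbb{T}=\mathbb{R}/\mathbb{Z}$ and let $\log_2$ be the base-2 logarithm, with $0\log 0=0$. Finite-state dimensions. For $x=x_0x_1x_2\dots\in\{0,1\}^{\mathbb{N}}$ and a word $w\in\{0,1\}^l$, let $P(x_0^{n-1},w)$ be the proportion of the positions $i\in\{0,\dots,n-l\}$ with $x_i\cdots x_{i+l-1}=w$ (for $n\ge l$), let $$H_l(x_0^{n-1})=-\frac1l\sum_{w\in\{0,1\}^l}P(x_0^{n-1},w)\log_2 P(x_0^{n-1},w),$$ and put $\dim_{FS}(x)=\inf_{l\ge1}\liminf_{n\to\infty}H_l(x_0^{n-1})$ and $\mathrm{Dim}_{FS}(x)=\inf_{l\ge1}\limsup_{n\to\infty}H_l(x_0^{n-1})$. For $r\in\mathbb{T}$ let $\dim_{FS}(r)$ and $\mathrm{Dim}_{FS}(r)$ be $\dim_{FS}(x)$ and $\mathrm{Dim}_{FS}(x)$ for the standard binary expansion $x$ of the representative of $r$ in $[0,1)$. Rényi dimensions. For an integer $m\ge2$ and a Borel probability measure $\mu$ on $\mathbb{T}$, let $\mathbf{H}^m_n(\mu)=-\sum_{I}\mu(I)\log\mu(I)$,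 where $I$ runs over the $m^n$ intervals $[a m^{-n},(a+1)m^{-n})$, $0\le a<m^n$, and let $$\underline{\dim}^m_R(\mu)=\liminf_{n\to\infty}\frac{\mathbf{H}^m_n(\mu)}{n\log m},\qquad \overline{\dim}^m_R(\mu)=\limsup_{n\to\infty}\frac{\mathbf{H}^m_n(\mu)}{n\log m}.$$ Theorem. Let $r\in\mathbb{T}$. (1) If $n_0<n_1<\cdots$ are natural numbers and $(c_k)_{k\in\mathbb{Z}}$ are complex numbers with $$\lim_{m\to\infty}\frac1{n_m}\sum_{j=0}^{n_m-1}e^{2\pi i k2^jr}=c_k\quad\text{for every }k\in\mathbb{Z},$$ then there is a Borel probability measure $\mu$ on $\mathbb{T}$ with $c_k=\int e^{2\pi iky}\,d\mu(y)$ for every $k\in\mathbb{Z}$. (2) Every $x\in\{0,1\}^{\mathbb{N}}$ with $\sum_i x_i2^{-i-1}\equiv r \pmod 1$ satisfies $\dim_{FS}(x)=\dim_{FS}(r)$ and $\mathrm{Dim}_{FS}(x)=\mathrm{Dim}_{FS}(r)$. (3) Let $\mathcal{W}_r$ be the set of all Borel probability measures $\mu$ on $\mathbb{T}$ for which there are natural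 numbers $n_0<n_1<\cdots$ such that $\lim_{m\to\infty}\frac1{n_m}\sum_{j=0}^{n_m-1}e^{2\pi i k2^jr}=\int e^{2\pi iky}\,d\mu(y)$ for every $k\in\mathbb{Z}$. Then $\mathcal{W}_r\neq\emptyset$ and, for every integer $m\ge2$, $$\dim_{FS}(r)=\inf_{\mu\in\mathcal{W}_r}\underline{\dim}^m_R(\mu)\qquad\text{and}\qquad \mathrm{Dim}_{FS}(r)=\sup_{\mu\in\mathcal{W}_r}\overline{\dim}^m_R(\mu).$$ -/

import Mathlib

open Filter Topology MeasureTheory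

noncomputable section

namespace FiniteStateWeyl

/-! ### Binary sequences and their finite-state dimensions -/

/-- The evaluation map `v(x) = ∑ i, x i / 2 ^ (i + 1) mod 1` from infinite binary sequences to the
torus `𝕋 = ℝ / ℤ`. -/
def binaryValue (x : ℕ → Fin 2) : UnitAddCircle :=
  ((Real.ofDigits x : ℝ) : UnitAddCircle)

/-- The standard binary expansion of a point of the torus: the binary digits of its
representative in `[0, 1)`. -/
def binaryExpansion (r : UnitAddCircle) : ℕ → Fin 2 :=
  Real.digits (AddCircle.equivIco (1 : ℝ) 0 r : ℝ) 2

theorem binaryValue_binaryExpansion (r : UnitAddCircle) :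
    binaryValue (binaryExpansion r) = r := by
  have h : (AddCircle.equivIco (1 : ℝ) 0 r : ℝ) ∈ Set.Ico (0 : ℝ) 1 :=
    ⟨(AddCircle.equivIco (1 : ℝ) 0 r).2.1,
      (AddCircle.equivIco (1 : ℝ) 0 r).2.2.trans_eq (zero_add 1)⟩
  unfold binaryValue binaryExpansion
  rw [Real.ofDigits_digits (by norm_num) h]
  exact (AddCircle.equivIco (1 : ℝ) 0).symm_apply_apply r

/-- The sliding count probability of the word `w` of length `l` in the prefix
`x 0, …, x (n - 1)` of `x`: the proportion of the positions `0 ≤ i ≤ n - l` at which `w` occurs.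
It is meaningful for `n ≥ l`, the only values that matter below, where `n → ∞` with `l` fixed. -/
def slidingProb (x : ℕ → Fin 2) (n : ℕ) {l : ℕ} (w : Fin l → Fin 2) : ℝ :=
  (((Finset.range (n + 1 - l)).filter (fun i => ∀ j : Fin l, x (i + j) = w j)).card : ℝ) /
    ((n : ℝ) - (l : ℝ) + 1)

/-- The sliding block entropy (base-2 logarithm) of the prefix of `x` of length `n` for blocks of
length `l`. -/
def slidingBlockEntropy (x : ℕ → Fin 2) (l n : ℕ) : ℝ :=
  -(1 / (l : ℝ)) * ∑ w : Fin l → Fin 2, slidingProb x n w * Real.logb 2 (slidingProb x n w)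

/-- The finite-state dimension of a binary sequence; block lengths are positive. -/
def finiteStateDim (x : ℕ → Fin 2) : ℝ :=
  ⨅ l : ℕ+, liminf (fun n : ℕ => slidingBlockEntropy x l n) atTop

/-- The finite-state strong dimension of a binary sequence. -/
def finiteStateStrongDim (x : ℕ → Fin 2) : ℝ :=
  ⨅ l : ℕ+, limsup (fun n : ℕ => slidingBlockEntropy x l n) atTop

/-- The finite-state dimension of a point of the torus, through its binary expansion. -/
def torusFiniteStateDim (r : UnitAddCircle) : ℝ := finiteStateDim (binaryExpansion r)

/-- The finite-state strong dimension of a point of the torus, through its binary expansion. -/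
def torusFiniteStateStrongDim (r : UnitAddCircle) : ℝ := finiteStateStrongDim (binaryExpansion r)

/-! ### Rényi dimensions of measures on the torus -/

/-- The `m`-adic interval `I_w = [v_m(w 0 0 0 …), v_m(w 0 0 0 …) + m ^ (-n))` in the torus, for a
word `w` of length `n` over the alphabet `{0, …, m - 1}`. -/
def adicInterval {m n : ℕ} (w : Fin n → Fin m) : Set UnitAddCircle :=
  (fun t : ℝ => (t : UnitAddCircle)) ''
    Set.Ico (∑ i : Fin n, ((w i : ℕ) : ℝ) / (m : ℝ) ^ ((i : ℕ) + 1))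
      ((∑ i : Fin n, ((w i : ℕ) : ℝ) / (m : ℝ) ^ ((i : ℕ) + 1)) + 1 / (m : ℝ) ^ n)

/-- The Shannon entropy of `μ` for the partition of the torus into `m`-adic intervals of
length `m ^ (-n)`. -/
def partitionEntropy (m n : ℕ) (μ : ProbabilityMeasure UnitAddCircle) : ℝ :=
  -∑ w : Fin n → Fin m, (μ : Measure UnitAddCircle).real (adicInterval w) *
    Real.log ((μ : Measure UnitAddCircle).real (adicInterval w))

/-- The upper Rényi dimension of `μ`, computed with the partition factor `m`. -/
def upperRenyiDim (m : ℕ) (μ : ProbabilityMeasure UnitAddCircle) : ℝ :=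
  limsup (fun n : ℕ => partitionEntropy m n μ / ((n : ℝ) * Real.log m)) atTop

/-- The lower Rényi dimension of `μ`, computed with the partition factor `m`. -/
def lowerRenyiDim (m : ℕ) (μ : ProbabilityMeasure UnitAddCircle) : ℝ :=
  liminf (fun n : ℕ => partitionEntropy m n μ / ((n : ℝ) * Real.log m)) atTop

/-! ### Weyl averages and their subsequence limits -/

/-- The Weyl average `(1 / n) ∑_{j < n} exp(2 π i k 2 ^ j r)`. -/
def weylAverage (r : UnitAddCircle) (k : ℤ) (n : ℕ) : ℂ :=
  (1 / (n : ℂ)) * ∑ j ∈ Finset.range n, fourier k ((2 ^ j : ℕ) • r)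

/-- The probability measures on the torus whose Fourier coefficients `∫ exp(2 π i k y) dμ(y)` are
the limits, for all `k` simultaneously, of the Weyl averages of `r` along a subsequence. -/
def weylLimitMeasures (r : UnitAddCircle) : Set (ProbabilityMeasure UnitAddCircle) :=
  {μ | ∃ n : ℕ → ℕ, StrictMono n ∧ ∀ k : ℤ,
    Tendsto (fun m : ℕ => weylAverage r k (n m)) atTop
      (𝓝 (∫ y : UnitAddCircle, fourier k y ∂(μ : Measure UnitAddCircle)))}

end FiniteStateWeyl

end

noncomputable section

namespace FiniteStateWeyl

/-! ### Entropy of finite-valued maps -/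

/-! Everything is lifted to the compact space of binary sequences, where cylinders are clopen, so
block entropies are weakly continuous. Up to an index shift by `l - 1`, sliding block entropies of
`x` are normalized block entropies of its empirical measures. Let `E` be the compact set of their
weak limits. Each `μ ∈ E` is shift-invariant, so by subadditivity its block entropy per symbol
converges to its infimum, the entropy rate `h(μ)`.

The evaluation map carries the shift to doubling, so Weyl averages are Fourier coefficients of
pushed-forward empirical measures. Compactness and uniqueness of Fourier coefficients identify the
Weyl limit measures with the images of `E` (`weylLimitMeasures_binaryValue`). Dyadic blocks and
`m`-adic intervals of comparable length meet boundedly many of each other, so both Rényi dimensions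
of the image of `μ` equal `h(μ) / log 2` for every `m`; ambiguous expansions cost only a bounded
error.

For fixed `l`, the liminf and limsup are the minimum and maximum of the block rate over `E`. The
lower formula interchanges two infima; the upper one is a minimax, obtained from compactness and
monotonicity along multiples (`exists_forall_blockRate_lt`). The resulting extrema depend only on
the point of the torus, hence not on its expansion. Nonemptiness is contained in `IsGLB`: the empty
set has no greatest lower bound in `ℝ`. -/

theorem negMulLog_le_of_pos {p q : ℝ} (hp : 0 ≤ p) (hq : 0 < q) :
    Real.negMulLog p ≤ -p * Real.log q + q - p := by
  rcases hp.eq_or_lt with rfl | hp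
  · simpa using hq.le
  have h := Real.log_le_sub_one_of_pos (div_pos hq hp)
  rw [Real.log_div hq.ne' hp.ne'] at h
  have h2 := mul_le_mul_of_nonneg_left h hp.le
  have h3 : p * (q / p - 1) = q - p := by field_simp
  rw [h3] at h2
  rw [Real.negMulLog]
  linarith

/-- Gibbs' inequality against the constant weight `s / C`. The masses need not sum to 1, so that it
applies to a single fibre. -/
theorem sum_negMulLog_le {ι : Type*} (S : Finset ι) (p : ι → ℝ) (hp : ∀ i ∈ S, 0 ≤ p i)
    {C : ℕ} (hC : 0 < C) (hS : S.card ≤ C) :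
    ∑ i ∈ S, Real.negMulLog (p i) ≤
      Real.negMulLog (∑ i ∈ S, p i) + (∑ i ∈ S, p i) * Real.log C := by
  set s := ∑ i ∈ S, p i with hs
  have hs0 : 0 ≤ s := Finset.sum_nonneg hp
  have hC' : (0 : ℝ) < C := by exact_mod_cast hC
  rcases hs0.eq_or_lt with h0 | h0
  · have hz := (Finset.sum_eq_zero_iff_of_nonneg hp).1 (hs.symm.trans h0.symm)
    rw [Finset.sum_congr rfl fun i hi => by rw [hz i hi]]
    simp [← h0]
  · calc ∑ i ∈ S, Real.negMulLog (p i)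
        ≤ ∑ i ∈ S, (-p i * Real.log (s / C) + s / C - p i) :=
          Finset.sum_le_sum fun i hi => negMulLog_le_of_pos (hp i hi) (div_pos h0 hC')
      _ = -s * Real.log (s / C) + S.card * (s / C) - s := by
          rw [Finset.sum_sub_distrib, Finset.sum_add_distrib, ← Finset.sum_mul,
            Finset.sum_neg_distrib, ← hs]
          simp
      _ ≤ -s * Real.log (s / C) + C * (s / C) - s := by gcongr
      _ = _ := by
          rw [Real.log_div h0.ne' hC'.ne', Real.negMulLog]
          field_simp
          ring

theorem negMulLog_sum_le {ι : Type*} (S : Finset ι) (p : ι → ℝ) (hp : ∀ i ∈ S, 0 ≤ p i) :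
    Real.negMulLog (∑ i ∈ S, p i) ≤ ∑ i ∈ S, Real.negMulLog (p i) := by
  rw [Real.negMulLog, ← Finset.sum_neg_distrib, Finset.sum_mul]
  refine Finset.sum_le_sum fun i hi => ?_
  rcases (hp i hi).eq_or_lt with h | h
  · simp [← h]
  · rw [Real.negMulLog]
    have := Real.log_le_log h (Finset.single_le_sum hp hi)
    nlinarith

/-- The Shannon entropy (natural logarithm) of a map with finitely many values. -/
def entropy {Ω ι : Type*} [MeasurableSpace Ω] [Fintype ι] (μ : Measure Ω) (f : Ω → ι) : ℝ :=
  ∑ i, Real.negMulLog (μ.real (f ⁻¹' {i}))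

theorem entropy_nonneg {Ω ι : Type*} [MeasurableSpace Ω] [Fintype ι] (μ : Measure Ω)
    [IsProbabilityMeasure μ] (f : Ω → ι) : 0 ≤ entropy μ f :=
  Finset.sum_nonneg fun _ _ => Real.negMulLog_nonneg measureReal_nonneg measureReal_le_one

section

variable {Ω ι κ : Type*} [MeasurableSpace Ω] [Fintype ι] [Fintype κ]
  [MeasurableSpace ι] [MeasurableSingletonClass ι] [MeasurableSpace κ] [MeasurableSingletonClass κ]
  (μ : Measure Ω) [IsProbabilityMeasure μ] {f : Ω → ι} {g : Ω → κ}

theorem sum_measureReal_inter_preimage (hg : Measurable g) {A : Set Ω} (hA : MeasurableSet A) :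
    ∑ j, μ.real (A ∩ g ⁻¹' {j}) = μ.real A := by
  have hU : A = ⋃ j, A ∩ g ⁻¹' {j} := by ext x; simp
  conv_rhs => rw [hU]
  rw [measureReal_iUnion_fintype]
  · intro i j hij
    refine Set.disjoint_left.2 fun x hx hx' => hij ?_
    exact hx.2.symm.trans hx'.2
  · exact fun j => hA.inter (hg (measurableSet_singleton j))

theorem sum_measureReal_preimage (hg : Measurable g) : ∑ j, μ.real (g ⁻¹' {j}) = 1 := by
  simpa using sum_measureReal_inter_preimage μ hg MeasurableSet.univ

/-- Given the value of `g`, at most `C` values of `f` remain, so the conditional entropy is at most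
`log C`. -/
theorem entropy_le_entropy_add_log (hf : Measurable f) (hg : Measurable g) {C : ℕ} (hC : 0 < C)
    (S : κ → Finset ι) (hS : ∀ j, (S j).card ≤ C) (hfg : ∀ ω, f ω ∈ S (g ω)) :
    entropy μ f ≤ entropy μ g + Real.log C := by
  have hfm : ∀ i, MeasurableSet (f ⁻¹' {i}) := fun i => hf (measurableSet_singleton i)
  have hgm : ∀ j, MeasurableSet (g ⁻¹' {j}) := fun j => hg (measurableSet_singleton j)
  have hz : ∀ j, ∀ i ∉ S j, μ.real (f ⁻¹' {i} ∩ g ⁻¹' {j}) = 0 := by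
    intro j i hi
    have : f ⁻¹' {i} ∩ g ⁻¹' {j} = ∅ := by
      ext ω
      simp only [Set.mem_inter_iff, Set.mem_preimage, Set.mem_singleton_iff,
        Set.mem_empty_iff_false, iff_false, not_and]
      rintro rfl rfl
      exact hi (hfg ω)
    simp [this]
  have hcol : ∀ j, ∑ i ∈ S j, μ.real (f ⁻¹' {i} ∩ g ⁻¹' {j}) = μ.real (g ⁻¹' {j}) := by
    intro j
    rw [Finset.sum_subset (Finset.subset_univ _) fun i _ hi => hz j i hi,
      ← sum_measureReal_inter_preimage μ hf (hgm j)]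
    simp_rw [Set.inter_comm]
  calc entropy μ f
      ≤ ∑ i, ∑ j, Real.negMulLog (μ.real (f ⁻¹' {i} ∩ g ⁻¹' {j})) := by
        refine Finset.sum_le_sum fun i _ => ?_
        rw [← sum_measureReal_inter_preimage μ hg (hfm i)]
        exact negMulLog_sum_le _ _ fun _ _ => measureReal_nonneg
    _ = ∑ j, ∑ i ∈ S j, Real.negMulLog (μ.real (f ⁻¹' {i} ∩ g ⁻¹' {j})) := by
        rw [Finset.sum_comm]
        refine Finset.sum_congr rfl fun j _ => ?_
        exact (Finset.sum_subset (Finset.subset_univ _) fun i _ hi => by simp [hz j i hi]).symm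
    _ ≤ ∑ j, (Real.negMulLog (μ.real (g ⁻¹' {j})) + μ.real (g ⁻¹' {j}) * Real.log C) := by
        refine Finset.sum_le_sum fun j _ => ?_
        rw [← hcol j]
        exact sum_negMulLog_le _ _ (fun _ _ => measureReal_nonneg) hC (hS j)
    _ = entropy μ g + Real.log C := by
        rw [Finset.sum_add_distrib, ← Finset.sum_mul, sum_measureReal_preimage μ hg, one_mul,
          entropy]

/-- Gibbs' inequality for the joint law against the product of its marginals. -/
theorem entropy_prod_le (hf : Measurable f) (hg : Measurable g) :
    entropy μ (fun ω => (f ω, g ω)) ≤ entropy μ f + entropy μ g := by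
  have hfm : ∀ i, MeasurableSet (f ⁻¹' {i}) := fun i => hf (measurableSet_singleton i)
  have hgm : ∀ j, MeasurableSet (g ⁻¹' {j}) := fun j => hg (measurableSet_singleton j)
  set M : ι → κ → ℝ := fun i j => μ.real (f ⁻¹' {i} ∩ g ⁻¹' {j}) with hM
  set a : ι → ℝ := fun i => μ.real (f ⁻¹' {i}) with ha
  set b : κ → ℝ := fun j => μ.real (g ⁻¹' {j}) with hb
  have hrow : ∀ i, ∑ j, M i j = a i := fun i => sum_measureReal_inter_preimage μ hg (hfm i)
  have hcol : ∀ j, ∑ i, M i j = b j := by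
    intro j
    simp only [hM, hb]
    rw [← sum_measureReal_inter_preimage μ hf (hgm j)]
    simp_rw [Set.inter_comm]
  have hM0 : ∀ i j, 0 ≤ M i j := fun _ _ => measureReal_nonneg
  have key : ∀ i j, Real.negMulLog (M i j) ≤
      -(M i j * Real.log (a i)) - M i j * Real.log (b j) + a i * b j - M i j := by
    intro i j
    have ha0 : 0 ≤ a i := measureReal_nonneg
    have hb0 : 0 ≤ b j := measureReal_nonneg
    rcases (hM0 i j).eq_or_lt with h | h
    · rw [← h]
      simpa using mul_nonneg ha0 hb0
    · have hai : 0 < a i := h.trans_le (measureReal_mono Set.inter_subset_left)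
      have hbj : 0 < b j := h.trans_le (measureReal_mono Set.inter_subset_right)
      have := negMulLog_le_of_pos h.le (mul_pos hai hbj)
      rw [Real.log_mul hai.ne' hbj.ne'] at this
      linarith
  have hsa : ∑ i, a i = 1 := sum_measureReal_preimage μ hf
  have hsb : ∑ j, b j = 1 := sum_measureReal_preimage μ hg
  have hpre : ∀ i j, (fun ω => (f ω, g ω)) ⁻¹' {(i, j)} = f ⁻¹' {i} ∩ g ⁻¹' {j} := by
    intro i j; ext ω; simp
  calc entropy μ (fun ω => (f ω, g ω)) = ∑ i, ∑ j, Real.negMulLog (M i j) := by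
        simp only [entropy, Fintype.sum_prod_type, hpre, hM]
    _ ≤ ∑ i, ∑ j, (-(M i j * Real.log (a i)) - M i j * Real.log (b j) + a i * b j - M i j) :=
        Finset.sum_le_sum fun i _ => Finset.sum_le_sum fun j _ => key i j
    _ = -(∑ i, (∑ j, M i j) * Real.log (a i)) - (∑ j, (∑ i, M i j) * Real.log (b j))
          + (∑ i, a i) * (∑ j, b j) - ∑ i, ∑ j, M i j := by
        rw [Finset.sum_mul_sum]
        simp only [Finset.sum_sub_distrib, Finset.sum_add_distrib, Finset.sum_neg_distrib,
          Finset.sum_mul]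
        rw [Finset.sum_comm (f := fun i j => M i j * Real.log (b j))]
    _ = entropy μ f + entropy μ g := by
        simp only [hrow, hcol, hsa, hsb, entropy, Real.negMulLog, neg_mul, Finset.sum_neg_distrib]
        simp only [ha, hb]
        ring

end

theorem entropy_map {Ω Ω' ι : Type*} [MeasurableSpace Ω] [MeasurableSpace Ω'] [Fintype ι]
    [MeasurableSpace ι] [MeasurableSingletonClass ι] (μ : Measure Ω) {T : Ω → Ω'} {f : Ω' → ι}
    (hT : Measurable T) (hf : Measurable f) :
    entropy (μ.map T) f = entropy μ (f ∘ T) := by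
  simp only [entropy, Set.preimage_comp]
  refine Finset.sum_congr rfl fun i _ => ?_
  rw [map_measureReal_apply hT (hf (measurableSet_singleton i))]

/-! ### Blocks and empirical measures on the space of binary sequences -/

/-- The `k`-fold shift of binary sequences. -/
def shiftBy (k : ℕ) (x : ℕ → Fin 2) : ℕ → Fin 2 := fun i => x (i + k)

/-- The first `l` symbols of a binary sequence. -/
def block (l : ℕ) (x : ℕ → Fin 2) : Fin l → Fin 2 := fun j => x j

theorem continuous_shiftBy (k : ℕ) : Continuous (shiftBy k) :=
  continuous_pi fun i => continuous_apply (i + k)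

theorem continuous_block (l : ℕ) : Continuous (block l) :=
  continuous_pi fun j => continuous_apply (j : ℕ)

theorem measurable_block (l : ℕ) : Measurable (block l) := (continuous_block l).measurable

theorem measurable_shiftBy (k : ℕ) : Measurable (shiftBy k) := (continuous_shiftBy k).measurable

/-- The uniform measure on the first `n` shifts of `x` (on `x` alone if `n = 0`). -/
def empirical (x : ℕ → Fin 2) (n : ℕ) : ProbabilityMeasure (ℕ → Fin 2) :=
  ⟨((max n 1 : ℕ) : ENNReal)⁻¹ • ∑ j ∈ Finset.range (max n 1), Measure.dirac (shiftBy j x), by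
    constructor
    simp only [Measure.smul_apply, Measure.finsetSum_apply, measure_univ, Finset.sum_const,
      Finset.card_range, nsmul_eq_mul, mul_one, smul_eq_mul]
    exact ENNReal.inv_mul_cancel (by simp) (ENNReal.natCast_ne_top _)⟩

theorem integral_empirical {E : Type*} [NormedAddCommGroup E] [NormedSpace ℝ E] [CompleteSpace E]
    (x : ℕ → Fin 2) {n : ℕ} (hn : 0 < n) (f : (ℕ → Fin 2) → E) :
    ∫ y, f y ∂(empirical x n : Measure (ℕ → Fin 2)) =
      (n : ℝ)⁻¹ • ∑ j ∈ Finset.range n, f (shiftBy j x) := by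
  simp only [empirical, ProbabilityMeasure.coe_mk, max_eq_left (show 1 ≤ n from hn)]
  rw [integral_smul_measure, integral_finsetSum_measure]
  · simp
  · intro j _
    exact integrable_dirac (by simp)

theorem empirical_real (x : ℕ → Fin 2) {n : ℕ} (hn : 0 < n) {A : Set (ℕ → Fin 2)}
    (hA : MeasurableSet A) [DecidablePred (fun j => shiftBy j x ∈ A)] :
    (empirical x n : Measure (ℕ → Fin 2)).real A =
      ((Finset.range n).filter (fun j => shiftBy j x ∈ A)).card / (n : ℝ) := by
  rw [← integral_indicator_one hA, integral_empirical x hn]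
  simp [Set.indicator_apply, Finset.sum_boole, div_eq_inv_mul]

/-- A prefix of length `n + l - 1` has exactly `n` starting positions for blocks of length `l`, one
for each atom of the empirical measure. -/
theorem slidingBlockEntropy_eq (x : ℕ → Fin 2) {l : ℕ} (hl : 0 < l) {n : ℕ} (hn : 0 < n) :
    slidingBlockEntropy x l (n + (l - 1)) =
      entropy (empirical x n : Measure (ℕ → Fin 2)) (block l) / (l * Real.log 2) := by
  have hp : ∀ w : Fin l → Fin 2, slidingProb x (n + (l - 1)) w =
      (empirical x n : Measure (ℕ → Fin 2)).real (block l ⁻¹' {w}) := by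
    intro w
    classical
    rw [empirical_real x hn (measurable_block l (measurableSet_singleton w)), slidingProb]
    congr 1
    · congr 1
      rw [show n + (l - 1) + 1 - l = n by omega]
      refine congrArg _ (Finset.filter_congr fun i _ => ?_)
      simp only [Set.mem_preimage, Set.mem_singleton_iff, funext_iff, block, shiftBy]
      simp_rw [add_comm i]
    · rw [Nat.cast_add, Nat.cast_sub hl]
      push_cast
      ring
  rw [slidingBlockEntropy, entropy, Finset.sum_div, Finset.mul_sum]
  refine Finset.sum_congr rfl fun w _ => ?_
  rw [hp, Real.negMulLog, Real.logb]
  have : Real.log 2 ≠ 0 := (Real.log_pos one_lt_two).ne'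
  have : (l : ℝ) ≠ 0 := by exact_mod_cast hl.ne'
  field_simp

theorem continuous_entropy_block (l : ℕ) :
    Continuous fun μ : ProbabilityMeasure (ℕ → Fin 2) =>
      entropy (μ : Measure (ℕ → Fin 2)) (block l) := by
  refine continuous_finsetSum _ fun w _ => Real.continuous_negMulLog.comp ?_
  have hc : IsClopen (block l ⁻¹' {w}) :=
    (isClopen_discrete ({w} : Set (Fin l → Fin 2))).preimage (continuous_block l)
  have : Continuous fun μ : ProbabilityMeasure (ℕ → Fin 2) => μ (block l ⁻¹' {w}) :=
    continuous_iff_continuousAt.2 fun μ =>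
      ProbabilityMeasure.tendsto_measure_of_isClopen_of_tendsto tendsto_id hc
  simp only [ProbabilityMeasure.measureReal_eq_coe_coeFn]
  exact NNReal.continuous_coe.comp this

/-! ### Cluster points of the empirical measures -/

/-- The weak limit points of the empirical measures of `x`. -/
def empiricalLimits (x : ℕ → Fin 2) : Set (ProbabilityMeasure (ℕ → Fin 2)) :=
  {μ | MapClusterPt μ atTop (empirical x)}

theorem isCompact_empiricalLimits (x : ℕ → Fin 2) : IsCompact (empiricalLimits x) :=
  isClosed_setOfPred_clusterPt.isCompact

theorem mem_empiricalLimits_iff {x : ℕ → Fin 2} {μ : ProbabilityMeasure (ℕ → Fin 2)} :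
    μ ∈ empiricalLimits x ↔
      ∃ n : ℕ → ℕ, StrictMono n ∧ Tendsto (fun m => empirical x (n m)) atTop (𝓝 μ) := by
  constructor
  · intro h
    exact MapClusterPt.tendsto_subseq h
  · rintro ⟨n, hn, h⟩
    exact MapClusterPt.of_comp hn.tendsto_atTop h.mapClusterPt

theorem exists_subseq_empirical (x : ℕ → Fin 2) (n : ℕ → ℕ) (hn : StrictMono n) :
    ∃ μ ∈ empiricalLimits x, ∃ φ : ℕ → ℕ, StrictMono φ ∧
      Tendsto (fun m => empirical x (n (φ m))) atTop (𝓝 μ) := by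
  obtain ⟨μ, -, φ, hφ, h⟩ :=
    isCompact_univ.tendsto_subseq (x := fun m => empirical x (n m)) fun _ => Set.mem_univ _
  exact ⟨μ, mem_empiricalLimits_iff.2 ⟨n ∘ φ, hn.comp hφ, h⟩, φ, hφ, h⟩

/-- Shifting an empirical average telescopes: the integral of `f` changes by only `(f (shiftBy n x)
- f x) / n`, at most `2 * ‖f‖ / n` in absolute value. -/
theorem map_shiftBy_one_eq {x : ℕ → Fin 2} {μ : ProbabilityMeasure (ℕ → Fin 2)}
    (hμ : μ ∈ empiricalLimits x) :
    (μ : Measure (ℕ → Fin 2)).map (shiftBy 1) = μ := by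
  obtain ⟨n, hn, h⟩ := mem_empiricalLimits_iff.1 hμ
  refine ext_of_forall_integral_eq_of_IsFiniteMeasure fun f => ?_
  rw [integral_map (measurable_shiftBy 1).aemeasurable
    f.continuous.measurable.aestronglyMeasurable]
  have h' := ProbabilityMeasure.tendsto_iff_forall_integral_tendsto.1 h
  have h1 := h' f
  have h2 := h' (f.compContinuous ⟨shiftBy 1, continuous_shiftBy 1⟩)
  refine tendsto_nhds_unique h2 ?_
  have h3 : Tendsto (fun m => (n m : ℝ)⁻¹ * (f (shiftBy (n m) x) - f x)) atTop (𝓝 0) := by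
    refine Tendsto.zero_mul_isBoundedUnder_le
      (tendsto_inv_atTop_zero.comp (tendsto_natCast_atTop_atTop.comp hn.tendsto_atTop))
      (isBoundedUnder_of ⟨2 * ‖f‖, fun m => ?_⟩)
    simpa [dist_eq_norm] using f.dist_le_two_norm (shiftBy (n m) x) x
  have h4 := h1.add h3
  rw [add_zero] at h4
  refine h4.congr' ?_
  filter_upwards [eventually_ge_atTop 1] with m hm
  have hnm : 0 < n m := lt_of_lt_of_le hm (hn.le_apply)
  rw [integral_empirical x hnm, integral_empirical x hnm, smul_eq_mul, smul_eq_mul, ← mul_add]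
  congr 1
  have hs : ∀ j, (f.compContinuous ⟨shiftBy 1, continuous_shiftBy 1⟩) (shiftBy j x) =
      f (shiftBy (j + 1) x) := by
    intro j
    refine congrArg f (funext fun i => ?_)
    simp [shiftBy, add_assoc, add_comm 1 j]
  simp only [hs]
  have := Finset.sum_range_sub (fun j => f (shiftBy j x)) (n m)
  rw [Finset.sum_sub_distrib] at this
  have h0 : shiftBy 0 x = x := rfl
  rw [h0] at this
  linarith

theorem map_shiftBy_eq {x : ℕ → Fin 2} {μ : ProbabilityMeasure (ℕ → Fin 2)}
    (hμ : μ ∈ empiricalLimits x) (k : ℕ) :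
    (μ : Measure (ℕ → Fin 2)).map (shiftBy k) = μ := by
  induction k with
  | zero => exact Measure.map_id
  | succ k ih =>
    have : shiftBy (k + 1) = shiftBy 1 ∘ shiftBy k := by
      funext y i
      simp [shiftBy, add_assoc, add_comm 1 k]
    rw [this, ← Measure.map_map (measurable_shiftBy 1) (measurable_shiftBy k), ih,
      map_shiftBy_one_eq hμ]

theorem subadditive_entropy_block {x : ℕ → Fin 2} {μ : ProbabilityMeasure (ℕ → Fin 2)}
    (hμ : μ ∈ empiricalLimits x) :
    Subadditive fun l => entropy (μ : Measure (ℕ → Fin 2)) (block l) := by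
  intro k l
  have hm : Measurable (block l ∘ shiftBy k) := (measurable_block l).comp (measurable_shiftBy k)
  have h1 := entropy_prod_le (μ : Measure (ℕ → Fin 2)) (measurable_block k) hm
  -- The long block is determined by the pair of short ones, so `C = 1` and the error is `log 1 =
  -- 0`.
  have h2 := entropy_le_entropy_add_log (μ : Measure (ℕ → Fin 2)) (measurable_block (k + l))
    ((measurable_block k).prodMk hm) one_pos (fun p => {Fin.append p.1 p.2})
    (fun _ => by simp) (fun y => by
      rw [Finset.mem_singleton]
      funext j
      refine Fin.addCases (fun j => ?_) (fun j => ?_) j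
      · simp [block]
      · simp [block, shiftBy, add_comm])
  rw [← entropy_map _ (measurable_shiftBy k) (measurable_block l), map_shiftBy_eq hμ k] at h1
  simp only [Nat.cast_one, Real.log_one, add_zero] at h2
  exact h2.trans h1

/-- The entropy rate (natural logarithm) of a shift-invariant measure, as an infimum. -/
def entropyRate (μ : ProbabilityMeasure (ℕ → Fin 2)) : ℝ :=
  ⨅ l : ℕ+, entropy (μ : Measure (ℕ → Fin 2)) (block l) / (l : ℕ)

theorem bddBelow_entropy_div (μ : ProbabilityMeasure (ℕ → Fin 2)) :
    BddBelow (Set.range fun l : ℕ => entropy (μ : Measure (ℕ → Fin 2)) (block l) / l) :=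
  ⟨0, by
    rintro _ ⟨l, rfl⟩
    exact div_nonneg (entropy_nonneg _ _) (Nat.cast_nonneg l)⟩

theorem entropyRate_le (μ : ProbabilityMeasure (ℕ → Fin 2)) {l : ℕ} (hl : 0 < l) :
    entropyRate μ ≤ entropy (μ : Measure (ℕ → Fin 2)) (block l) / l := by
  refine ciInf_le (f := fun l : ℕ+ => entropy (μ : Measure (ℕ → Fin 2)) (block l) / (l : ℕ))
    ?_ ⟨l, hl⟩
  exact (bddBelow_entropy_div μ).mono (by rintro _ ⟨l, rfl⟩; exact ⟨l, rfl⟩)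

theorem tendsto_entropy_div {x : ℕ → Fin 2} {μ : ProbabilityMeasure (ℕ → Fin 2)}
    (hμ : μ ∈ empiricalLimits x) :
    Tendsto (fun l : ℕ => entropy (μ : Measure (ℕ → Fin 2)) (block l) / l) atTop
      (𝓝 (entropyRate μ)) := by
  have h := (subadditive_entropy_block hμ).tendsto_lim (bddBelow_entropy_div μ)
  convert h using 2
  refine le_antisymm (ge_of_tendsto h ?_) (le_ciInf fun l => ?_)
  · filter_upwards [eventually_gt_atTop 0] with l hl using entropyRate_le μ hl
  · exact (subadditive_entropy_block hμ).lim_le_div (bddBelow_entropy_div μ) l.ne_zero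

theorem entropy_mul_div_le {x : ℕ → Fin 2} {μ : ProbabilityMeasure (ℕ → Fin 2)}
    (hμ : μ ∈ empiricalLimits x) {k l : ℕ} (hk : 0 < k) (hl : 0 < l) :
    entropy (μ : Measure (ℕ → Fin 2)) (block (k * l)) / ((k * l : ℕ) : ℝ) ≤
      entropy (μ : Measure (ℕ → Fin 2)) (block l) / l := by
  -- Remainder `l` instead of `0` keeps the entropy of the empty block out of the bound.
  have h := (subadditive_entropy_block hμ).apply_mul_add_le (k - 1) l l
  rw [← Nat.succ_mul, Nat.succ_eq_add_one, Nat.sub_add_cancel hk] at h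
  rw [Nat.cast_sub hk] at h
  have hk' : (0 : ℝ) < k := by exact_mod_cast hk
  have hl' : (0 : ℝ) < l := by exact_mod_cast hl
  rw [Nat.cast_mul, div_le_div_iff₀ (by positivity) hl']
  push_cast at h
  nlinarith

/-! ### Adic intervals of the torus -/

theorem equivIco_mem (y : UnitAddCircle) :
    (AddCircle.equivIco (1 : ℝ) 0 y : ℝ) ∈ Set.Ico (0 : ℝ) 1 :=
  ⟨(AddCircle.equivIco (1 : ℝ) 0 y).2.1,
    (AddCircle.equivIco (1 : ℝ) 0 y).2.2.trans_eq (zero_add 1)⟩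

theorem equivIco_coe {t : ℝ} (ht : t ∈ Set.Ico (0 : ℝ) 1) :
    (AddCircle.equivIco (1 : ℝ) 0 (t : UnitAddCircle) : ℝ) = t := by
  rw [AddCircle.equivIco_coe_eq (by simpa using ht)]

/-- The index of the interval `[a / M, (a + 1) / M)` that contains a point of the torus. -/
def torusCell (M : ℕ) [NeZero M] (y : UnitAddCircle) : Fin M :=
  ⟨⌊(M : ℝ) * (AddCircle.equivIco (1 : ℝ) 0 y : ℝ)⌋₊, by
    have hM : (0 : ℝ) < M := by exact_mod_cast NeZero.pos M
    have h := equivIco_mem y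
    rw [Nat.floor_lt (mul_nonneg hM.le h.1)]
    nlinarith [h.2]⟩

theorem measurable_torusCell (M : ℕ) [NeZero M] : Measurable (torusCell M) := by
  refine measurable_to_countable' fun a => ?_
  have : Measurable fun y : UnitAddCircle =>
      ⌊(M : ℝ) * (AddCircle.equivIco (1 : ℝ) 0 y : ℝ)⌋₊ :=
    Nat.measurable_floor.comp ((measurable_subtype_coe.comp
      (AddCircle.measurableEquivIco (1 : ℝ) 0).measurable).const_mul _)
  convert this (measurableSet_singleton (a : ℕ)) using 1
  ext y
  simp [torusCell, Fin.ext_iff]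

/-- The integer whose base-`m` digits, most significant first, are the letters of a word. -/
def wordIndex (m n : ℕ) : (Fin n → Fin m) ≃ Fin (m ^ n) :=
  (Fin.revPerm.arrowCongr (Equiv.refl _)).trans finFunctionFinEquiv

theorem sum_div_pow_eq_wordIndex {m n : ℕ} (hm : 0 < m) (w : Fin n → Fin m) :
    ∑ i : Fin n, ((w i : ℕ) : ℝ) / (m : ℝ) ^ ((i : ℕ) + 1) =
      (wordIndex m n w : ℕ) / ((m ^ n : ℕ) : ℝ) := by
  have hm' : (m : ℝ) ≠ 0 := by exact_mod_cast hm.ne'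
  simp only [wordIndex, Equiv.trans_apply, finFunctionFinEquiv_apply]
  rw [← Equiv.sum_comp Fin.revPerm]
  push_cast
  rw [Finset.sum_div]
  refine Finset.sum_congr rfl fun i _ => ?_
  have hn : (m : ℝ) ^ n = m ^ (n - (i + 1) + 1) * m ^ (i : ℕ) := by
    rw [← pow_add]; congr 1; omega
  rw [hn]
  simp only [Fin.revPerm_apply, Fin.val_rev, Equiv.arrowCongr_apply, Function.comp_apply,
    Equiv.coe_refl, id, Fin.revPerm_symm]
  field_simp

theorem mem_adicInterval_iff {m n : ℕ} [NeZero m] (w : Fin n → Fin m) (y : UnitAddCircle) :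
    y ∈ adicInterval w ↔ torusCell (m ^ n) y = wordIndex m n w := by
  have hM : (0 : ℝ) < ((m ^ n : ℕ) : ℝ) := by exact_mod_cast NeZero.pos (m ^ n)
  rw [adicInterval, sum_div_pow_eq_wordIndex (NeZero.pos m) w, ← Nat.cast_pow]
  set M := m ^ n
  set N := wordIndex m n w
  have hN : (N : ℝ) + 1 ≤ M := by exact_mod_cast N.2
  rw [← add_div]
  constructor
  · rintro ⟨t, ⟨h1, h2⟩, rfl⟩
    have h0 : t ∈ Set.Ico (0 : ℝ) 1 :=
      ⟨le_trans (by positivity) h1, h2.trans_le ((div_le_one hM).2 hN)⟩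
    rw [div_le_iff₀ hM] at h1
    rw [lt_div_iff₀ hM] at h2
    simp only [torusCell, Fin.ext_iff, equivIco_coe h0]
    rw [Nat.floor_eq_iff (mul_nonneg hM.le h0.1)]
    constructor <;> linarith
  · intro h
    have h0 := equivIco_mem y
    simp only [torusCell, Fin.ext_iff] at h
    rw [Nat.floor_eq_iff (mul_nonneg hM.le h0.1)] at h
    refine ⟨_, ⟨?_, ?_⟩, (AddCircle.equivIco (1 : ℝ) 0).symm_apply_apply y⟩
    · rw [div_le_iff₀ hM]; linarith [h.1]
    · rw [lt_div_iff₀ hM]; linarith [h.2]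

theorem partitionEntropy_eq (m n : ℕ) [NeZero m] (μ : ProbabilityMeasure UnitAddCircle) :
    partitionEntropy m n μ = entropy (μ : Measure UnitAddCircle) (torusCell (m ^ n)) := by
  rw [partitionEntropy, entropy, ← Finset.sum_neg_distrib, ← Equiv.sum_comp (wordIndex m n)]
  refine Finset.sum_congr rfl fun w _ => ?_
  have : adicInterval w = torusCell (m ^ n) ⁻¹' {wordIndex m n w} := by
    ext y; simp [mem_adicInterval_iff]
  rw [this, Real.negMulLog, neg_mul]

/-! ### Comparison of binary blocks with adic intervals -/

theorem continuous_binaryValue : Continuous binaryValue :=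
  (AddCircle.continuous_mk' (1 : ℝ)).comp Real.continuous_ofDigits

theorem two_pow_mul_ofDigits (x : ℕ → Fin 2) (l : ℕ) :
    ((2 ^ l : ℕ) : ℝ) * Real.ofDigits x =
      (wordIndex 2 l (block l x) : ℕ) + Real.ofDigits (shiftBy l x) := by
  have h := Real.ofDigits_eq_sum_add_ofDigits x l
  have hs : ∑ i ∈ Finset.range l, Real.ofDigitsTerm x i =
      (wordIndex 2 l (block l x) : ℕ) / ((2 ^ l : ℕ) : ℝ) := by
    rw [← sum_div_pow_eq_wordIndex two_pos, Finset.sum_range]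
    simp [Real.ofDigitsTerm, block, div_eq_mul_inv]
  have hp : (0 : ℝ) < ((2 ^ l : ℕ) : ℝ) := by positivity
  rw [h, hs, mul_add, mul_div_cancel₀ _ hp.ne', ← mul_assoc]
  push_cast
  rw [mul_inv_cancel₀ (by positivity), one_mul]
  rfl

/-- The upper end is closed because a tail consisting only of ones has value 1. -/
theorem wordIndex_block_le (x : ℕ → Fin 2) (l : ℕ) :
    ((wordIndex 2 l (block l x) : ℕ) : ℝ) ≤ ((2 ^ l : ℕ) : ℝ) * Real.ofDigits x ∧
      ((2 ^ l : ℕ) : ℝ) * Real.ofDigits x ≤ (wordIndex 2 l (block l x) : ℕ) + 1 := by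
  have h := two_pow_mul_ofDigits x l
  have h0 := Real.ofDigits_nonneg (shiftBy l x)
  have h1 := Real.ofDigits_le_one (shiftBy l x)
  constructor <;> linarith

theorem binaryValue_shiftBy (x : ℕ → Fin 2) (j : ℕ) :
    binaryValue (shiftBy j x) = (2 ^ j : ℕ) • binaryValue x := by
  have h : Real.ofDigits (shiftBy j x) =
      (2 ^ j : ℕ) • Real.ofDigits x - (wordIndex 2 j (block j x) : ℕ) • (1 : ℝ) := by
    rw [nsmul_eq_mul, nsmul_eq_mul, two_pow_mul_ofDigits]
    ring
  rw [binaryValue, binaryValue, h, AddCircle.coe_sub, AddCircle.coe_nsmul, AddCircle.coe_nsmul,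
    AddCircle.coe_period, smul_zero, sub_zero]

/-- Value 1 wraps around to the point 0 of the torus; this exceptional case is why extra candidates
appear in the two counts below. -/
theorem torusCell_binaryValue (M : ℕ) [NeZero M] (x : ℕ → Fin 2) :
    (Real.ofDigits x < 1 ∧
      (torusCell M (binaryValue x) : ℕ) = ⌊(M : ℝ) * Real.ofDigits x⌋₊) ∨
    (Real.ofDigits x = 1 ∧ (torusCell M (binaryValue x) : ℕ) = 0) := by
  rcases (Real.ofDigits_le_one x).lt_or_eq with h | h
  · refine Or.inl ⟨h, ?_⟩
    simp only [torusCell, binaryValue, equivIco_coe ⟨Real.ofDigits_nonneg x, h⟩]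
  · refine Or.inr ⟨h, ?_⟩
    have h1 : binaryValue x = ((0 : ℝ) : UnitAddCircle) := by
      rw [binaryValue, h, AddCircle.coe_period, AddCircle.coe_zero]
    simp only [torusCell, h1, equivIco_coe (show (0 : ℝ) ∈ Set.Ico (0 : ℝ) 1 by simp)]
    simp

theorem card_filter_val_mem_le {α : Type*} [Fintype α] (e : α → ℕ) (he : Function.Injective e)
    (T : Finset ℕ) : (Finset.univ.filter fun a => e a ∈ T).card ≤ T.card :=
  Finset.card_le_card_of_injOn e (fun a ha => by simpa using ha) he.injOn

section

variable (μ : Measure (ℕ → Fin 2)) [IsProbabilityMeasure μ] {M l : ℕ} [NeZero M]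

/-- A dyadic interval is no longer than a cell, so it meets only the cells `B w` and `B w + 1`; cell
0 allows for wraparound. Three would do; 5 matches the converse bound. -/
theorem entropy_torusCell_le (h1 : M ≤ 2 ^ l) :
    entropy μ (torusCell M ∘ binaryValue) ≤ entropy μ (block l) + Real.log 5 := by
  have hK : (0 : ℝ) < ((2 ^ l : ℕ) : ℝ) := by positivity
  have hM : (0 : ℝ) < M := by exact_mod_cast NeZero.pos M
  have h1' : (M : ℝ) ≤ ((2 ^ l : ℕ) : ℝ) := by exact_mod_cast h1
  set B : (Fin l → Fin 2) → ℕ := fun w => ⌊(M : ℝ) * (wordIndex 2 l w : ℕ) / ((2 ^ l : ℕ) : ℝ)⌋₊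
  refine entropy_le_entropy_add_log μ (C := 5)
    ((measurable_torusCell M).comp continuous_binaryValue.measurable) (measurable_block l)
    (by norm_num)
    (fun w => Finset.univ.filter fun c => (c : ℕ) ∈ ({0, B w, B w + 1} : Finset ℕ))
    (fun w => (card_filter_val_mem_le _ Fin.val_injective _).trans
      (Finset.card_le_three.trans (by norm_num))) fun x => ?_
  simp only [Finset.mem_filter, Finset.mem_univ, true_and, Finset.mem_insert,
    Finset.mem_singleton, Function.comp_apply]
  obtain ⟨ha, hb⟩ := wordIndex_block_le x l
  rcases torusCell_binaryValue M x with ⟨-, hc⟩ | ⟨-, hc⟩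
  · rw [hc]
    right
    set A : ℝ := ((wordIndex 2 l (block l x) : ℕ) : ℝ)
    have hlo : B (block l x) ≤ ⌊(M : ℝ) * Real.ofDigits x⌋₊ := by
      refine Nat.floor_le_floor ?_
      rw [div_le_iff₀ hK]
      nlinarith
    have hhi : ⌊(M : ℝ) * Real.ofDigits x⌋₊ ≤ B (block l x) + 1 := by
      rw [← Nat.floor_add_one (by positivity)]
      refine Nat.floor_le_floor ?_
      rw [div_add_one hK.ne', le_div_iff₀ hK]
      nlinarith
    omega
  · exact Or.inl hc

/-- A cell has length at most 2 in units of `2 ^ (-l)`, leaving block indices `B c - 1` to `B c +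
2`; the lowest occurs for a tail of ones. The fifth candidate, `2 ^ l - 1`, is the all-ones word,
whose value may wrap to 0. -/
theorem entropy_block_le (h2 : 2 ^ l ≤ 2 * M) :
    entropy μ (block l) ≤ entropy μ (torusCell M ∘ binaryValue) + Real.log 5 := by
  have hK : (0 : ℝ) < ((2 ^ l : ℕ) : ℝ) := by positivity
  have hM : (0 : ℝ) < M := by exact_mod_cast NeZero.pos M
  have h2' : ((2 ^ l : ℕ) : ℝ) ≤ 2 * M := by exact_mod_cast h2
  set B : Fin M → ℕ := fun c => ⌊((2 ^ l : ℕ) : ℝ) * (c : ℕ) / M⌋₊ with hB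
  refine entropy_le_entropy_add_log μ (C := 5) (measurable_block l)
    ((measurable_torusCell M).comp continuous_binaryValue.measurable) (by norm_num)
    (fun c => Finset.univ.filter fun w => (wordIndex 2 l w : ℕ) ∈
      ({B c - 1, B c, B c + 1, B c + 2, 2 ^ l - 1} : Finset ℕ))
    (fun c => (card_filter_val_mem_le (fun w => (wordIndex 2 l w : ℕ))
      (Fin.val_injective.comp (wordIndex 2 l).injective) _).trans Finset.card_le_five) fun x => ?_
  simp only [Finset.mem_filter, Finset.mem_univ, true_and, Finset.mem_insert,
    Finset.mem_singleton, Function.comp_apply]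
  obtain ⟨ha, hb⟩ := wordIndex_block_le x l
  set A := (wordIndex 2 l (block l x) : ℕ)
  rcases torusCell_binaryValue M x with ⟨-, hc⟩ | ⟨h, -⟩
  · set c := torusCell M (binaryValue x)
    have hpos : 0 ≤ (M : ℝ) * Real.ofDigits x := mul_nonneg hM.le (Real.ofDigits_nonneg x)
    have hc1 := Nat.floor_le hpos
    have hc2 := Nat.lt_floor_add_one ((M : ℝ) * Real.ofDigits x)
    rw [← hc] at hc1 hc2
    have hpos' : 0 ≤ ((2 ^ l : ℕ) : ℝ) * (c : ℕ) / M := by positivity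
    have hB1 : (B c : ℝ) ≤ ((2 ^ l : ℕ) : ℝ) * (c : ℕ) / M := Nat.floor_le hpos'
    have hB2 : ((2 ^ l : ℕ) : ℝ) * (c : ℕ) / M < B c + 1 := Nat.lt_floor_add_one _
    have hlo : ((2 ^ l : ℕ) : ℝ) * (c : ℕ) / M ≤ A + 1 := by
      rw [div_le_iff₀ hM]
      nlinarith
    have hhi : (A : ℝ) < ((2 ^ l : ℕ) : ℝ) * (c : ℕ) / M + 2 := by
      rw [div_add' _ _ _ hM.ne', lt_div_iff₀ hM]
      nlinarith
    have e1 : B c ≤ A + 1 := by exact_mod_cast hB1.trans hlo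
    have e2 : A < B c + 3 := by
      have : (A : ℝ) < B c + 3 := by linarith
      exact_mod_cast this
    omega
  · rw [h, mul_one] at hb
    have e1 : 2 ^ l ≤ A + 1 := by exact_mod_cast hb
    have e2 : A < 2 ^ l := (wordIndex 2 l (block l x)).2
    omega

end

/-! ### Rényi dimensions of the images of the weak limit points -/

/-- The image on the torus of a measure on binary sequences. -/
def pushBinary (μ : ProbabilityMeasure (ℕ → Fin 2)) : ProbabilityMeasure UnitAddCircle :=
  μ.map continuous_binaryValue.measurable.aemeasurable

theorem toMeasure_pushBinary (μ : ProbabilityMeasure (ℕ → Fin 2)) :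
    (pushBinary μ : Measure UnitAddCircle) = (μ : Measure (ℕ → Fin 2)).map binaryValue :=
  ProbabilityMeasure.toMeasure_map _ _

theorem abs_partitionEntropy_sub_le (μ : ProbabilityMeasure (ℕ → Fin 2)) {m n l : ℕ} (hm : 0 < m)
    (h1 : m ^ n ≤ 2 ^ l) (h2 : 2 ^ l ≤ 2 * m ^ n) :
    |partitionEntropy m n (pushBinary μ) - entropy (μ : Measure (ℕ → Fin 2)) (block l)| ≤
      Real.log 5 := by
  have : NeZero m := ⟨hm.ne'⟩
  rw [partitionEntropy_eq, toMeasure_pushBinary,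
    entropy_map _ continuous_binaryValue.measurable (measurable_torusCell _), abs_sub_le_iff]
  have e1 := entropy_torusCell_le (μ : Measure (ℕ → Fin 2)) h1
  have e2 := entropy_block_le (μ : Measure (ℕ → Fin 2)) h2
  constructor <;> linarith

theorem two_pow_clog_le {a : ℕ} (ha : 1 < a) : 2 ^ Nat.clog 2 a ≤ 2 * a := by
  have h := Nat.pow_pred_clog_lt_self one_lt_two ha
  have h0 := Nat.clog_pos one_lt_two ha
  rw [← Nat.succ_pred_eq_of_pos h0, pow_succ]
  omega

theorem tendsto_clog_pow_div {m : ℕ} (hm : 2 ≤ m) :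
    Tendsto (fun n : ℕ => (Nat.clog 2 (m ^ n) : ℝ) / (n * Real.log m)) atTop
      (𝓝 (1 / Real.log 2)) := by
  have h2 : 0 < Real.log 2 := Real.log_pos one_lt_two
  have hlm : 0 < Real.log m := Real.log_pos (by exact_mod_cast hm)
  have hup : Tendsto (fun n : ℕ => 1 / Real.log 2 + 1 / (n * Real.log m)) atTop
      (𝓝 (1 / Real.log 2)) := by
    have : Tendsto (fun n : ℕ => (n : ℝ) * Real.log m) atTop atTop :=
      tendsto_natCast_atTop_atTop.atTop_mul_const hlm
    simpa using (tendsto_const_nhds (x := 1 / Real.log 2)).add (tendsto_inv_atTop_zero.comp this)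
  refine tendsto_of_tendsto_of_tendsto_of_le_of_le' tendsto_const_nhds hup ?_ ?_
  · filter_upwards [eventually_gt_atTop 0] with n hn
    have hn' : (0 : ℝ) < n := by exact_mod_cast hn
    have h : (m : ℝ) ^ n ≤ 2 ^ Nat.clog 2 (m ^ n) := by
      exact_mod_cast Nat.le_pow_clog one_lt_two (m ^ n)
    have h' := Real.log_le_log (by positivity) h
    rw [Real.log_pow, Real.log_pow] at h'
    rw [div_le_div_iff₀ h2 (by positivity)]
    linarith
  · filter_upwards [eventually_gt_atTop 0] with n hn
    have hn' : (0 : ℝ) < n := by exact_mod_cast hn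
    have h : (2 : ℝ) ^ Nat.clog 2 (m ^ n) ≤ 2 * (m : ℝ) ^ n := by
      exact_mod_cast two_pow_clog_le (Nat.one_lt_pow hn.ne' hm)
    have h' := Real.log_le_log (by positivity) h
    rw [Real.log_mul (by norm_num) (by positivity), Real.log_pow, Real.log_pow] at h'
    rw [div_add_div _ _ h2.ne' (by positivity), div_le_div_iff₀ (by positivity) (by positivity)]
    nlinarith [mul_pos hn' hlm]

theorem tendsto_clog_pow {m : ℕ} (hm : 2 ≤ m) :
    Tendsto (fun n : ℕ => Nat.clog 2 (m ^ n)) atTop atTop := by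
  refine tendsto_atTop_mono (fun n => ?_) tendsto_id
  have h : 2 ^ n ≤ 2 ^ Nat.clog 2 (m ^ n) :=
    (Nat.pow_le_pow_left hm n).trans (Nat.le_pow_clog one_lt_two _)
  exact (Nat.pow_le_pow_iff_right one_lt_two).1 h

/-- With `l = Nat.clog 2 (m ^ n)`, the quotient is `(H_l / l) * (l / (n * log m))` plus an error of
at most `log 5 / (n * log m)`, where `H_l` is the block entropy. -/
theorem tendsto_partitionEntropy_div {x : ℕ → Fin 2} {μ : ProbabilityMeasure (ℕ → Fin 2)}
    (hμ : μ ∈ empiricalLimits x) {m : ℕ} (hm : 2 ≤ m) :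
    Tendsto (fun n : ℕ => partitionEntropy m n (pushBinary μ) / ((n : ℝ) * Real.log m)) atTop
      (𝓝 (entropyRate μ / Real.log 2)) := by
  have hlm : 0 < Real.log m := Real.log_pos (by exact_mod_cast hm)
  have h1 := ((tendsto_entropy_div hμ).comp (tendsto_clog_pow hm)).mul (tendsto_clog_pow_div hm)
  have hinf : Tendsto (fun n : ℕ => (n : ℝ) * Real.log m) atTop atTop :=
    tendsto_natCast_atTop_atTop.atTop_mul_const hlm
  have h2 : Tendsto (fun n : ℕ => (partitionEntropy m n (pushBinary μ) -
      entropy (μ : Measure (ℕ → Fin 2)) (block (Nat.clog 2 (m ^ n)))) * ((n : ℝ) * Real.log m)⁻¹)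
      atTop (𝓝 0) := by
    refine bdd_le_mul_tendsto_zero' (Real.log 5) ?_ (tendsto_inv_atTop_zero.comp hinf)
    filter_upwards [eventually_gt_atTop 0] with n hn
    exact abs_partitionEntropy_sub_le μ (two_pos.trans_le hm) (Nat.le_pow_clog one_lt_two _)
      (two_pow_clog_le (Nat.one_lt_pow hn.ne' hm))
  have h3 := h1.add h2
  rw [add_zero, mul_one_div] at h3
  refine h3.congr' ?_
  filter_upwards [eventually_gt_atTop 0] with n hn
  have hn' : (0 : ℝ) < n := by exact_mod_cast hn
  have hl : (Nat.clog 2 (m ^ n) : ℝ) ≠ 0 := by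
    exact_mod_cast (Nat.clog_pos one_lt_two (Nat.one_lt_pow hn.ne' hm)).ne'
  simp only [Function.comp_apply]
  field_simp
  ring

theorem lowerRenyiDim_pushBinary {x : ℕ → Fin 2} {μ : ProbabilityMeasure (ℕ → Fin 2)}
    (hμ : μ ∈ empiricalLimits x) {m : ℕ} (hm : 2 ≤ m) :
    lowerRenyiDim m (pushBinary μ) = entropyRate μ / Real.log 2 :=
  (tendsto_partitionEntropy_div hμ hm).liminf_eq

theorem upperRenyiDim_pushBinary {x : ℕ → Fin 2} {μ : ProbabilityMeasure (ℕ → Fin 2)}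
    (hμ : μ ∈ empiricalLimits x) {m : ℕ} (hm : 2 ≤ m) :
    upperRenyiDim m (pushBinary μ) = entropyRate μ / Real.log 2 :=
  (tendsto_partitionEntropy_div hμ hm).limsup_eq

/-! ### Weyl averages -/

/-- By linearity the integrals agree on trigonometric polynomials, a star subalgebra separating
points, which determines the measure. -/
theorem eq_of_integral_fourier_eq {P Q : ProbabilityMeasure UnitAddCircle}
    (h : ∀ k : ℤ, ∫ y : UnitAddCircle, fourier k y ∂(P : Measure UnitAddCircle) =
      ∫ y : UnitAddCircle, fourier k y ∂(Q : Measure UnitAddCircle)) : P = Q := by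
  have hint : ∀ (R : ProbabilityMeasure UnitAddCircle) (f : C(UnitAddCircle, ℂ)),
      Integrable f (R : Measure UnitAddCircle) := fun R f =>
    (BoundedContinuousFunction.mkOfCompact f).integrable _
  have key : ∀ f ∈ Submodule.span ℂ (Set.range (@fourier 1)),
      ∫ y, f y ∂(P : Measure UnitAddCircle) = ∫ y, f y ∂(Q : Measure UnitAddCircle) := by
    intro f hf
    induction hf using Submodule.span_induction with
    | mem f hf => obtain ⟨k, rfl⟩ := hf; exact h k
    | zero => simp
    | add f g _ _ hf hg =>
      simp only [ContinuousMap.add_apply]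
      rw [integral_add (hint P f) (hint P g), integral_add (hint Q f) (hint Q g), hf, hg]
    | smul c f _ hf =>
      simp only [ContinuousMap.smul_apply]
      rw [integral_smul, integral_smul, hf]
  apply ProbabilityMeasure.toMeasure_injective
  refine ext_of_forall_mem_subalgebra_integral_eq_of_polish (𝕜 := ℂ)
    (A := (fourierSubalgebra (T := 1)).comap (BoundedContinuousFunction.toContinuousMapStarₐ ℂ))
    ?_ fun g hg => ?_
  · intro y z hyz
    obtain ⟨_, ⟨f, hf, rfl⟩, hne⟩ := fourierSubalgebra_separatesPoints (T := 1) hyz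
    exact ⟨f, ⟨f, ⟨BoundedContinuousFunction.mkOfCompact f, hf, rfl⟩, rfl⟩, hne⟩
  · refine key (g : C(UnitAddCircle, ℂ)) ?_
    rw [← fourierSubalgebra_coe]
    exact hg

theorem weylAverage_binaryValue (x : ℕ → Fin 2) (k : ℤ) {n : ℕ} (hn : 0 < n) :
    weylAverage (binaryValue x) k n =
      ∫ y : UnitAddCircle, fourier k y ∂(pushBinary (empirical x n) : Measure UnitAddCircle) := by
  rw [toMeasure_pushBinary, integral_map continuous_binaryValue.measurable.aemeasurable
    (fourier k).continuous.aestronglyMeasurable, integral_empirical x hn, weylAverage]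
  simp only [binaryValue_shiftBy, Complex.real_smul]
  push_cast
  rw [one_div]

theorem tendsto_weylAverage {x : ℕ → Fin 2} {μ : ProbabilityMeasure (ℕ → Fin 2)} {n : ℕ → ℕ}
    (hn : StrictMono n) (h : Tendsto (fun m => empirical x (n m)) atTop (𝓝 μ)) (k : ℤ) :
    Tendsto (fun m => weylAverage (binaryValue x) k (n m)) atTop
      (𝓝 (∫ y : UnitAddCircle, fourier k y ∂(pushBinary μ : Measure UnitAddCircle))) := by
  have h1 := ProbabilityMeasure.tendsto_map_of_tendsto_of_continuous _ _ h continuous_binaryValue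
  have h2 := (ProbabilityMeasure.tendsto_iff_forall_integral_rclike_tendsto ℂ).1 h1
    (BoundedContinuousFunction.mkOfCompact (fourier k))
  refine h2.congr' ?_
  filter_upwards [eventually_ge_atTop 1] with m hm
  rw [weylAverage_binaryValue x k (lt_of_lt_of_le hm hn.le_apply)]
  rfl

/-- The empirical measures themselves need not converge along `n`; a further subsequence does, and
the Weyl averages keep their limits along it. -/
theorem exists_pushBinary_eq_of_tendsto {x : ℕ → Fin 2} {n : ℕ → ℕ} {c : ℤ → ℂ}
    (hn : StrictMono n)
    (h : ∀ k : ℤ, Tendsto (fun m => weylAverage (binaryValue x) k (n m)) atTop (𝓝 (c k))) :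
    ∃ μ ∈ empiricalLimits x,
      ∀ k, c k = ∫ y : UnitAddCircle, fourier k y ∂(pushBinary μ : Measure UnitAddCircle) := by
  obtain ⟨μ, hμ, φ, hφ, hlim⟩ := exists_subseq_empirical x n hn
  refine ⟨μ, hμ, fun k => tendsto_nhds_unique ((h k).comp hφ.tendsto_atTop) ?_⟩
  exact tendsto_weylAverage (hn.comp hφ) hlim k

theorem weylLimitMeasures_binaryValue (x : ℕ → Fin 2) :
    weylLimitMeasures (binaryValue x) = pushBinary '' empiricalLimits x := by
  ext P
  constructor
  · rintro ⟨n, hn, h⟩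
    obtain ⟨μ, hμ, hc⟩ := exists_pushBinary_eq_of_tendsto hn h
    exact ⟨μ, hμ, (eq_of_integral_fourier_eq hc).symm⟩
  · rintro ⟨μ, hμ, rfl⟩
    obtain ⟨n, hn, h⟩ := mem_empiricalLimits_iff.1 hμ
    exact ⟨n, hn, tendsto_weylAverage hn h⟩

/-! ### Finite-state dimensions through the weak limit points -/

/-- The normalized base-2 entropy of a measure on blocks of length `l`. -/
def blockRate (l : ℕ) (μ : ProbabilityMeasure (ℕ → Fin 2)) : ℝ :=
  entropy (μ : Measure (ℕ → Fin 2)) (block l) / (l * Real.log 2)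

theorem blockRate_eq (l : ℕ) (μ : ProbabilityMeasure (ℕ → Fin 2)) :
    blockRate l μ = entropy (μ : Measure (ℕ → Fin 2)) (block l) / l / Real.log 2 := by
  rw [blockRate, div_div]

theorem continuous_blockRate (l : ℕ) : Continuous (blockRate l) :=
  (continuous_entropy_block l).div_const _

theorem blockRate_nonneg (l : ℕ) (μ : ProbabilityMeasure (ℕ → Fin 2)) : 0 ≤ blockRate l μ :=
  div_nonneg (entropy_nonneg _ _) (mul_nonneg l.cast_nonneg (Real.log_pos one_lt_two).le)

theorem isBounded_range_blockRate (l : ℕ) : Bornology.IsBounded (Set.range (blockRate l)) :=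
  (isCompact_range (continuous_blockRate l)).isBounded

theorem setOf_mapClusterPt_blockRate (x : ℕ → Fin 2) (l : ℕ) :
    {a | MapClusterPt a atTop fun n => blockRate l (empirical x n)} =
      blockRate l '' empiricalLimits x := by
  ext a
  constructor
  · intro ha
    obtain ⟨n, hn, h⟩ := MapClusterPt.tendsto_subseq ha
    obtain ⟨μ, hμ, φ, hφ, hlim⟩ := exists_subseq_empirical x n hn
    refine ⟨μ, hμ, tendsto_nhds_unique ?_ (h.comp hφ.tendsto_atTop)⟩
    exact ((continuous_blockRate l).tendsto μ).comp hlim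
  · rintro ⟨μ, hμ, rfl⟩
    exact MapClusterPt.continuousAt_comp (continuous_blockRate l).continuousAt hμ

theorem isBoundedUnder_le_blockRate (x : ℕ → Fin 2) (l : ℕ) :
    IsBoundedUnder (· ≤ ·) atTop fun n => blockRate l (empirical x n) := by
  obtain ⟨b, hb⟩ := (isBounded_range_blockRate l).bddAbove
  exact isBoundedUnder_of ⟨b, fun n => hb ⟨_, rfl⟩⟩

theorem isBoundedUnder_ge_blockRate (x : ℕ → Fin 2) (l : ℕ) :
    IsBoundedUnder (· ≥ ·) atTop fun n => blockRate l (empirical x n) :=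
  isBoundedUnder_of ⟨0, fun _ => blockRate_nonneg _ _⟩

theorem eventuallyEq_slidingBlockEntropy (x : ℕ → Fin 2) (l : ℕ+) :
    (fun n => slidingBlockEntropy x l (n + ((l : ℕ) - 1))) =ᶠ[atTop]
      fun n => blockRate l (empirical x n) := by
  filter_upwards [eventually_gt_atTop 0] with n hn using slidingBlockEntropy_eq x l.pos hn

/-- The liminf of a bounded real sequence is its least cluster point, and the index shift by `l - 1`
does not affect it. -/
theorem isLeast_liminf_slidingBlockEntropy (x : ℕ → Fin 2) (l : ℕ+) :
    IsLeast (blockRate l '' empiricalLimits x)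
      (liminf (fun n : ℕ => slidingBlockEntropy x l n) atTop) := by
  rw [← liminf_nat_add _ ((l : ℕ) - 1), liminf_congr (eventuallyEq_slidingBlockEntropy x l),
    ← setOf_mapClusterPt_blockRate]
  exact isLeast_mapClusterPt_liminf (isBoundedUnder_le_blockRate x l).isCoboundedUnder_ge
    (isBoundedUnder_ge_blockRate x l)

theorem isGreatest_limsup_slidingBlockEntropy (x : ℕ → Fin 2) (l : ℕ+) :
    IsGreatest (blockRate l '' empiricalLimits x)
      (limsup (fun n : ℕ => slidingBlockEntropy x l n) atTop) := by
  rw [← limsup_nat_add _ ((l : ℕ) - 1), limsup_congr (eventuallyEq_slidingBlockEntropy x l),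
    ← setOf_mapClusterPt_blockRate]
  exact isGreatest_mapClusterPt_limsup (isBoundedUnder_ge_blockRate x l).isCoboundedUnder_le
    (isBoundedUnder_le_blockRate x l)

theorem entropyRate_div_le_blockRate (μ : ProbabilityMeasure (ℕ → Fin 2)) (l : ℕ+) :
    entropyRate μ / Real.log 2 ≤ blockRate l μ := by
  rw [blockRate_eq]
  exact div_le_div_of_nonneg_right (entropyRate_le μ l.pos) (Real.log_pos one_lt_two).le

theorem exists_blockRate_lt (μ : ProbabilityMeasure (ℕ → Fin 2)) {b : ℝ}
    (hb : entropyRate μ / Real.log 2 < b) : ∃ l : ℕ+, blockRate l μ < b := by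
  have h2 : 0 < Real.log 2 := Real.log_pos one_lt_two
  rw [div_lt_iff₀ h2] at hb
  obtain ⟨l, hl⟩ := exists_lt_of_ciInf_lt hb
  exact ⟨l, by rwa [blockRate_eq, div_lt_iff₀ h2]⟩

theorem blockRate_le_of_dvd {x : ℕ → Fin 2} {μ : ProbabilityMeasure (ℕ → Fin 2)}
    (hμ : μ ∈ empiricalLimits x) {l L : ℕ} (hL : 0 < L) (h : l ∣ L) :
    blockRate L μ ≤ blockRate l μ := by
  obtain ⟨k, rfl⟩ := h
  rw [blockRate_eq, blockRate_eq, mul_comm l k]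
  exact div_le_div_of_nonneg_right (entropy_mul_div_le hμ (pos_of_mul_pos_right hL l.zero_le)
    (pos_of_mul_pos_left hL k.zero_le)) (Real.log_pos one_lt_two).le

/-- A Dini-type argument: finitely many open sets `{blockRate l < b}` cover the limit set, and a
common multiple of their lengths serves all limits at once, since block rates do not increase along
multiples. -/
theorem exists_forall_blockRate_lt (x : ℕ → Fin 2) {b : ℝ}
    (hb : ∀ μ ∈ empiricalLimits x, entropyRate μ / Real.log 2 < b) :
    ∃ L : ℕ+, ∀ μ ∈ empiricalLimits x, blockRate L μ < b := by
  obtain ⟨t, ht⟩ := (isCompact_empiricalLimits x).elim_finite_subcover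
    (fun l : ℕ+ => {μ | blockRate l μ < b})
    (fun l => isOpen_lt (continuous_blockRate l) continuous_const)
    (fun μ hμ => Set.mem_iUnion.2 (exists_blockRate_lt μ (hb μ hμ)))
  refine ⟨∏ l ∈ t, l, fun μ hμ => ?_⟩
  obtain ⟨l, hl, hlt⟩ := Set.mem_iUnion₂.1 (ht hμ)
  refine lt_of_le_of_lt (blockRate_le_of_dvd hμ (PNat.pos _) ?_) hlt
  exact PNat.dvd_iff.1 (Finset.dvd_prod_of_mem _ hl)

theorem isGLB_finiteStateDim (x : ℕ → Fin 2) :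
    IsGLB ((fun μ => entropyRate μ / Real.log 2) '' empiricalLimits x) (finiteStateDim x) := by
  have hbdd : BddBelow (Set.range fun l : ℕ+ =>
      liminf (fun n : ℕ => slidingBlockEntropy x l n) atTop) := by
    refine ⟨0, ?_⟩
    rintro _ ⟨l, rfl⟩
    obtain ⟨μ, -, h⟩ := (isLeast_liminf_slidingBlockEntropy x l).1
    exact (blockRate_nonneg l μ).trans_eq h
  constructor
  · rintro _ ⟨μ, hμ, rfl⟩
    refine le_of_forall_gt_imp_ge_of_dense fun b hb => ?_
    obtain ⟨l, hl⟩ := exists_blockRate_lt μ hb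
    exact (ciInf_le hbdd l).trans
      (((isLeast_liminf_slidingBlockEntropy x l).2 ⟨μ, hμ, rfl⟩).trans hl.le)
  · intro b hb
    refine le_ciInf fun l => ?_
    obtain ⟨μ, hμ, h⟩ := (isLeast_liminf_slidingBlockEntropy x l).1
    rw [← h]
    exact (hb ⟨μ, hμ, rfl⟩).trans (entropyRate_div_le_blockRate μ l)

theorem isLUB_finiteStateStrongDim (x : ℕ → Fin 2) :
    IsLUB ((fun μ => entropyRate μ / Real.log 2) '' empiricalLimits x)
      (finiteStateStrongDim x) := by
  have hbdd : BddBelow (Set.range fun l : ℕ+ =>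
      limsup (fun n : ℕ => slidingBlockEntropy x l n) atTop) := by
    refine ⟨0, ?_⟩
    rintro _ ⟨l, rfl⟩
    obtain ⟨μ, -, h⟩ := (isGreatest_limsup_slidingBlockEntropy x l).1
    exact (blockRate_nonneg l μ).trans_eq h
  constructor
  · rintro _ ⟨μ, hμ, rfl⟩
    exact le_ciInf fun l => (entropyRate_div_le_blockRate μ l).trans
      ((isGreatest_limsup_slidingBlockEntropy x l).2 ⟨μ, hμ, rfl⟩)
  · intro b hb
    -- The slack `c > b` supplies the strict inequalities that the open cover needs.
    refine le_of_forall_gt_imp_ge_of_dense fun c hc => ?_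
    obtain ⟨L, hL⟩ := exists_forall_blockRate_lt x fun μ hμ => (hb ⟨μ, hμ, rfl⟩).trans_lt hc
    obtain ⟨μ, hμ, h⟩ := (isGreatest_limsup_slidingBlockEntropy x L).1
    exact (ciInf_le hbdd L).trans (h.symm.trans_le (hL μ hμ).le)

/-! ### Dimension formulas on the torus -/

theorem isGLB_lowerRenyiDim (x : ℕ → Fin 2) {m : ℕ} (hm : 2 ≤ m) :
    IsGLB (lowerRenyiDim m '' weylLimitMeasures (binaryValue x)) (finiteStateDim x) := by
  rw [weylLimitMeasures_binaryValue, Set.image_image,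
    Set.image_congr fun μ hμ => lowerRenyiDim_pushBinary hμ hm]
  exact isGLB_finiteStateDim x

theorem isLUB_upperRenyiDim (x : ℕ → Fin 2) {m : ℕ} (hm : 2 ≤ m) :
    IsLUB (upperRenyiDim m '' weylLimitMeasures (binaryValue x)) (finiteStateStrongDim x) := by
  rw [weylLimitMeasures_binaryValue, Set.image_image,
    Set.image_congr fun μ hμ => upperRenyiDim_pushBinary hμ hm]
  exact isLUB_finiteStateStrongDim x

end FiniteStateWeyl

end

theorem mainTheorem6 (r : UnitAddCircle) :
    -- limits of the Weyl averages along a subsequence are Fourier coefficients of a measure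
    (∀ (n : ℕ → ℕ) (c : ℤ → ℂ), StrictMono n →
      (∀ k : ℤ, Tendsto (fun m : ℕ => FiniteStateWeyl.weylAverage r k (n m)) atTop (𝓝 (c k))) →
      ∃ μ : ProbabilityMeasure UnitAddCircle,
        ∀ k : ℤ, c k = ∫ y : UnitAddCircle, fourier k y ∂(μ : Measure UnitAddCircle)) ∧
    -- the dimensions of `r` do not depend on the binary expansion of `r`
    (∀ x : ℕ → Fin 2, FiniteStateWeyl.binaryValue x = r →
      FiniteStateWeyl.finiteStateDim x = FiniteStateWeyl.torusFiniteStateDim r ∧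
      FiniteStateWeyl.finiteStateStrongDim x = FiniteStateWeyl.torusFiniteStateStrongDim r) ∧
    -- the two formulas, for every partition factor
    (∀ m : ℕ, 2 ≤ m →
      IsGLB (FiniteStateWeyl.lowerRenyiDim m '' FiniteStateWeyl.weylLimitMeasures r)
        (FiniteStateWeyl.torusFiniteStateDim r) ∧
      IsLUB (FiniteStateWeyl.upperRenyiDim m '' FiniteStateWeyl.weylLimitMeasures r)
        (FiniteStateWeyl.torusFiniteStateStrongDim r)) := by
  have hr := FiniteStateWeyl.binaryValue_binaryExpansion r
  have hlow : ∀ m : ℕ, 2 ≤ m →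
      IsGLB (FiniteStateWeyl.lowerRenyiDim m '' FiniteStateWeyl.weylLimitMeasures r)
        (FiniteStateWeyl.torusFiniteStateDim r) := fun m hm => by
    simpa only [hr, FiniteStateWeyl.torusFiniteStateDim,
      FiniteStateWeyl.torusFiniteStateStrongDim] using
      FiniteStateWeyl.isGLB_lowerRenyiDim (FiniteStateWeyl.binaryExpansion r) hm
  have hupp : ∀ m : ℕ, 2 ≤ m →
      IsLUB (FiniteStateWeyl.upperRenyiDim m '' FiniteStateWeyl.weylLimitMeasures r)
        (FiniteStateWeyl.torusFiniteStateStrongDim r) := fun m hm => by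
    simpa only [hr, FiniteStateWeyl.torusFiniteStateDim,
      FiniteStateWeyl.torusFiniteStateStrongDim] using
      FiniteStateWeyl.isLUB_upperRenyiDim (FiniteStateWeyl.binaryExpansion r) hm
  refine ⟨fun n c hn h => ?_, ?_, fun m hm => ⟨hlow m hm, hupp m hm⟩⟩
  · rw [← hr] at h
    obtain ⟨μ, -, hμ⟩ := FiniteStateWeyl.exists_pushBinary_eq_of_tendsto hn h
    exact ⟨_, hμ⟩
  · rintro x rfl
    -- Both expansions yield bounds of the same set of Rényi dimensions, and such bounds are unique;
    -- the factor 2 is an arbitrary choice.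
    exact ⟨(FiniteStateWeyl.isGLB_lowerRenyiDim x le_rfl).unique (hlow 2 le_rfl),
      (FiniteStateWeyl.isLUB_upperRenyiDim x le_rfl).unique (hupp 2 le_rfl)⟩
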